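/- Let $\sigma>0$ and $\rho\in[0,1)$, and let $X=(X_1,X_2)$ be a bivariate Gaussian vector with mean zero and covariance matrix $\sigma^2\begin{bmatrix}1&\rho\\ \rho&1\end{bmatrix}$; let $f_X$ be its probability density on $\mathbb{R}^2$. A scheduling policy is a measurable function $\mathcal{U}:\mathbb{R}^2\to\{1,2\}$; it sends the packet $Y=(U,X_U)$, with $U=\mathcal{U}(X_1,X_2)$, to an estimator. An estimation policy is a function $\mathcal{E}:\{1,2\}\times\mathbb{R}\to\mathbb{R}^2$, which produces the estimates $(\hat X_1,\hat X_2)=\mathcal{E}(Y)$. The cost of the pair is $$\mathcal{J}(\mathcal{U},\mathcal{E})=\mathbf{E}\big[(X_1-\hat X_1)^2+(X_2-\hat X_2)^2\big].$$ For $(a_1,a_2)\in\mathbb{R}^2$, the piecewise linear estimation policy $\mathcal{E}^{\mathrm{linear}}_{(a_1,a_2)}$ is given by $\mathcal{E}^{\mathrm{linear}}_{(a_1,a_2)}(1,\xi)=(\xi,\,a_2\xi)$ and $\mathcal{E}^{\mathrm{linear}}_{(a_1,a_2)}(2,\xi)=(a_1\xi,\,\xi)$. The max-scheduling policy is $\mathcal{U}^{\max}(x_1,x_2)=1$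 if $|x_1|\ge|x_2|$, and $\mathcal{U}^{\max}(x_1,x_2)=2$ otherwise. Then $\int_{\mathbb{R}^2}x_1^2\,\mathbf{1}(|x_1|\ge|x_2|)\,f_X(x)\,dx>0$, and with $$a^\star=\frac{\rho\,\sigma^2}{2\int_{\mathbb{R}^2}x_1^2\,\mathbf{1}(|x_1|\ge|x_2|)\,f_X(x)\,dx}$$ the pair $(\mathcal{U}^{\max},\mathcal{E}^{\mathrm{linear}}_{(a^\star,a^\star)})$ is globally optimal among all pairs of a scheduling policy and a piecewise linear estimation policy: $$\mathcal{J}\big(\mathcal{U}^{\max},\mathcal{E}^{\mathrm{linear}}_{(a^\star,a^\star)}\big)\le\mathcal{J}\big(\mathcal{U},\mathcal{E}^{\mathrm{linear}}_{(a_1,a_2)}\big)\quad\text{for every scheduling policy }\mathcal{U}\text{ and all }(a_1,a_2)\in\mathbb{R}^2.$$ -/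

import Mathlib

open MeasureTheory ProbabilityTheory
open scoped ENNReal Matrix

noncomputable section

namespace SensorScheduling

/-- The plane `ℝ²`. The coordinate of the first sensor has index `0`, that of the second sensor
has index `1`. -/
abbrev Plane : Type := EuclideanSpace ℝ (Fin 2)

/-- A packet `(i, ξ)`: the index `i` of the sensor that is revealed, and the real number `ξ` that
it has observed. -/
abbrev Packet : Type := Fin 2 × ℝ

/-- The covariance matrix `σ² [1 ρ; ρ 1]` of two symmetric sources. -/
def symmetricCov (σ ρ : ℝ) : Matrix (Fin 2) (Fin 2) ℝ :=
  σ ^ 2 • !![1, ρ; ρ, 1]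

/-- The admissible scheduling policies: all measurable functions of both observations with values
in the set of sensor indices. -/
def schedulingPolicies : Set (Plane → Fin 2) :=
  {U | Measurable U}

/-- The packet that the estimator receives when the observations are `x` and the scheduling
policy is `U`. -/
def packet (U : Plane → Fin 2) (x : Plane) : Packet :=
  (U x, x (U x))

/-- The piecewise linear estimation policy with slopes `a = (a₁, a₂)`: the received value is kept,
and the other source is estimated by a multiple of the received value. -/
def linearEstimator (a : Plane) (y : Packet) : Plane :=
  if y.1 = 0 then !₂[y.2, a 1 * y.2] else !₂[a 0 * y.2, y.2]

/-- The class of all piecewise linear estimation policies. -/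
def linearEstimators : Set (Packet → Plane) :=
  Set.range linearEstimator

/-- The max-scheduling policy: reveal the observation with the largest absolute value. -/
def maxScheduling (x : Plane) : Fin 2 :=
  if |x 0| ≥ |x 1| then 0 else 1

variable {Ω : Type*} [MeasurableSpace Ω]

/-- The mean-squared error `E[(X₁ - X̂₁)² + (X₂ - X̂₂)²]` of the policy pair `(U, E)`, an expectation
of a nonnegative random variable with values in `[0, ∞]`. -/
def cost (P : Measure Ω) (X : Ω → Plane) (U : Plane → Fin 2) (E : Packet → Plane) : ℝ≥0∞ :=
  ∫⁻ ω, ENNReal.ofReal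
    ((X ω 0 - E (packet U (X ω)) 0) ^ 2 + (X ω 1 - E (packet U (X ω)) 1) ^ 2) ∂P

/-- The pair `(U, E)` is globally optimal when the scheduling policy is an arbitrary admissible one
and the estimation policy is constrained to the class `𝓔`. -/
def IsGloballyOptimal (P : Measure Ω) (X : Ω → Plane) (𝓔 : Set (Packet → Plane))
    (U : Plane → Fin 2) (E : Packet → Plane) : Prop :=
  U ∈ schedulingPolicies ∧ E ∈ 𝓔 ∧
    ∀ U' ∈ schedulingPolicies, ∀ E' ∈ 𝓔, cost P X U E ≤ cost P X U' E'

/-- The integral `∫ x₁² 1(|x₁| ≥ |x₂|) f_X(x) dx` over the plane, where `f_X` is the density of `X`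
with respect to Lebesgue measure. -/
def maxMoment (P : Measure Ω) (X : Ω → Plane) : ℝ :=
  ∫ x : Plane, (x 0) ^ 2 * (if |x 0| ≥ |x 1| then (1 : ℝ) else 0) * (pdf X P volume x).toReal

/-- The slope `ρ σ² / (2 ∫ x₁² 1(|x₁| ≥ |x₂|) f_X(x) dx)`. -/
def optimalSlope (P : Measure Ω) (X : Ω → Plane) (σ ρ : ℝ) : ℝ :=
  ρ * σ ^ 2 / (2 * maxMoment P X)

end SensorScheduling

end

noncomputable section

namespace SensorScheduling

/-! For fixed slopes the best schedule reveals the source that leaves the smaller error, so every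
cost is at least E min(u², v²) with u = X₂ - a₂X₁ and v = X₁ - a₁X₂ (`lintegral_min_le_cost`). For a
common slope t with t² ≤ 1, max-scheduling attains this bound, because u² - v² = (1 - t²)(X₂² - X₁²)
(`cost_maxScheduling`). It remains to minimise E min(u², v²) over the slopes.

Since min(u², v²) = (u² + v²)/2 - |(u - v)(u + v)|/2, the task is to bound above the mean absolute
product of two linear forms in independent standard Gaussians. With c = 2/π, `integral_abs_mul_le`
gives the bound √(c² det² + inner²) in terms of the determinant and inner product of the coefficient
vectors. It is sharp for orthogonal forms, hence for equal slopes.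

With s = √(1 - ρ²), `sqrt_le_quadratic` then shows that no cost is below σ² s²(1 - c²)/(1 + cs), the
value at the common slope ρ/(1 + cs). By `two_mul_maxMoment` this slope is a⋆. -/

/-! ### Trigonometric inequality for the angle between two linear forms. -/

open Real in
/-- On `[0, π/2]` the function `cos β + β sin β` lies below the chord in the variable `sin² β`. -/
lemma two_div_pi_mul_cos_add_le_of_nonneg {β : ℝ} (h0 : 0 ≤ β) (h1 : β ≤ π / 2) :
    2 / π * (cos β + β * sin β) ≤ 2 / π + (1 - 2 / π) * sin β ^ 2 := by
  set c := 2 / π with hc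
  have hcpos : 0 < c := by positivity
  have hc1 : c * (π / 2) = 1 := by rw [hc]; field_simp
  have hc2 : c < 1 := by rw [hc, div_lt_one pi_pos]; linarith [pi_gt_three]
  let g : ℝ → ℝ := fun x ↦ c + (1 - c) * sin x ^ 2 - c * (cos x + x * sin x)
  let k : ℝ → ℝ := fun x ↦ 2 * (1 - c) * sin x - c * x
  have hg : ∀ x, HasDerivAt g (cos x * k x) x := by
    intro x
    have := ((((hasDerivAt_sin x).pow 2).const_mul (1 - c)).const_add c).sub
      (((hasDerivAt_cos x).add ((hasDerivAt_id x).mul (hasDerivAt_sin x))).const_mul c)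
    convert! this using 1
    simp [k]; ring
  have hgc : Continuous g := by fun_prop
  have hk : ConcaveOn ℝ (Set.Icc 0 (π / 2)) k := by
    have h : ConcaveOn ℝ (Set.Icc 0 (π / 2)) sin :=
      (strictConcaveOn_sin_Icc.concaveOn).subset
        (Set.Icc_subset_Icc le_rfl (by linarith [pi_pos])) (convex_Icc _ _)
    refine (h.smul (by linarith : 0 ≤ 2 * (1 - c))).sub ?_
    exact ((convexOn_id (convex_Icc _ _)).smul hcpos.le)
  have hk0 : k 0 = 0 := by simp [k]
  have hcos : ∀ x ∈ Set.Icc 0 (π / 2), 0 ≤ cos x := fun x hx ↦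
    cos_nonneg_of_mem_Icc ⟨by linarith [hx.1, pi_pos], hx.2⟩
  have key : 0 ≤ g β := by
    -- As `k` is concave with k(0) = 0, it changes sign at most once, from + to -. So `g` rises and
    -- then falls between its zeros 0 and π/2; the sign of k(β) tells from which zero to compare.
    by_cases hs : 0 ≤ k β
    · have hmono : MonotoneOn g (Set.Icc 0 β) := by
        refine monotoneOn_of_deriv_nonneg (convex_Icc _ _) hgc.continuousOn
          (fun x _ ↦ (hg x).differentiableAt.differentiableWithinAt) fun x hx ↦ ?_
        rw [interior_Icc] at hx
        rw [(hg x).deriv]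
        refine mul_nonneg (hcos x ⟨hx.1.le, by linarith [hx.2]⟩) ?_
        have := hk.min_le_of_mem_Icc (x := 0) (y := β) (z := x)
          ⟨le_rfl, by positivity⟩ ⟨h0, h1⟩ ⟨hx.1.le, hx.2.le⟩
        rw [hk0, min_eq_left hs] at this
        exact this
      have := hmono (Set.left_mem_Icc.2 h0) (Set.right_mem_Icc.2 h0) h0
      simpa [g] using this
    · push Not at hs
      have hanti : AntitoneOn g (Set.Icc β (π / 2)) := by
        refine antitoneOn_of_deriv_nonpos (convex_Icc _ _) hgc.continuousOn
          (fun x _ ↦ (hg x).differentiableAt.differentiableWithinAt) fun x hx ↦ ?_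
        rw [interior_Icc] at hx
        rw [(hg x).deriv]
        refine mul_nonpos_of_nonneg_of_nonpos (hcos x ⟨by linarith [hx.1], hx.2.le⟩) ?_
        by_contra! hx'
        have := hk.min_le_of_mem_Icc (x := 0) (y := x) (z := β)
          ⟨le_rfl, by positivity⟩ ⟨by linarith [hx.1], hx.2.le⟩ ⟨h0, hx.1.le⟩
        rw [hk0, min_eq_left hx'.le] at this
        linarith
      have := hanti (Set.left_mem_Icc.2 h1) (Set.right_mem_Icc.2 h1) h1
      have h2 : g (π / 2) = 0 := by simp only [g, sin_pi_div_two, cos_pi_div_two]; linarith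
      linarith
  simp only [g] at key
  linarith

-- The left side is unchanged under δ ↦ π - δ, so the chord bound at β = |π/2 - δ| covers both
-- halves of [0, π].
open Real in
lemma two_div_pi_mul_sin_add_le_sqrt {δ : ℝ} (h0 : 0 ≤ δ) (h1 : δ ≤ π) :
    2 / π * (sin δ + (π / 2 - δ) * cos δ) ≤ √((2 / π) ^ 2 * sin δ ^ 2 + cos δ ^ 2) := by
  have hchord : 2 / π * (sin δ + (π / 2 - δ) * cos δ) ≤ 2 / π + (1 - 2 / π) * cos δ ^ 2 := by
    rcases le_total δ (π / 2) with h | h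
    · have := two_div_pi_mul_cos_add_le_of_nonneg (β := π / 2 - δ) (by linarith) (by linarith)
      rwa [cos_pi_div_two_sub, sin_pi_div_two_sub] at this
    · have := two_div_pi_mul_cos_add_le_of_nonneg (β := δ - π / 2) (by linarith) (by linarith)
      rw [cos_sub_pi_div_two, sin_sub_pi_div_two] at this
      linarith [this]
  refine hchord.trans (le_sqrt_of_sq_le ?_)
  have hs : sin δ ^ 2 = 1 - cos δ ^ 2 := by linarith [sin_sq_add_cos_sq δ]
  rw [hs]
  have h2 : 0 ≤ 1 - cos δ ^ 2 := by rw [← hs]; positivity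
  -- The gap between the two sides is exactly (1 - c)² cos² δ (1 - cos² δ) with c = 2/π.
  nlinarith [mul_nonneg (mul_nonneg (sq_nonneg (1 - 2 / π)) (sq_nonneg (cos δ))) h2]

/-! ### Algebraic optimisation over the two slopes. -/

/-- A quadratic inequality in `d, m`, uniform over the unit vectors `(k, l)`. -/
lemma quadratic_nonneg_of_unit {c s ρ d m k l N : ℝ} (hc0 : 0 < c) (hc1 : c < 1) (hs0 : 0 < s)
    (hs1 : s ≤ 1) (hρ : ρ ^ 2 = 1 - s ^ 2) (hkl : k ^ 2 + l ^ 2 = 1)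
    (hN : N * (1 + c * s) = 2 * c * s ^ 2 * (s + c)) :
    0 ≤ N + (d ^ 2 + m ^ 2) / 2
      - k * (c * s / 2 * (4 * s ^ 2 - 4 * ρ * m + d ^ 2 - m ^ 2)) - l * (d * m) := by
  have hk1 : k ≤ 1 := by nlinarith [sq_nonneg l]
  have hcs : c * s < 1 := by nlinarith
  have hcs0 : 0 < c * s := mul_pos hc0 hs0
  set p := 1 - c * s * k with hp
  set q := 1 - c ^ 2 * s ^ 2 with hq
  have hp0 : 0 < p := by rw [hp]; nlinarith
  have hq0 : 0 < q := by rw [hq]; nlinarith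
  set F := N + (d ^ 2 + m ^ 2) / 2
      - k * (c * s / 2 * (4 * s ^ 2 - 4 * ρ * m + d ^ 2 - m ^ 2)) - l * (d * m) with hF
  -- Complete the square in d, whose square has coefficient p/2 in `F`.
  have h1 : 2 * p * F = (p * d - l * m) ^ 2 + k ^ 2 * q * m ^ 2 + 4 * c * s * ρ * k * p * m
      + 2 * p * (N - 2 * c * s ^ 3 * k) := by
    have : l ^ 2 = 1 - k ^ 2 := by linarith
    have e : (p * d - l * m) ^ 2 = p ^ 2 * d ^ 2 - 2 * p * d * l * m + (1 - k ^ 2) * m ^ 2 := by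
      rw [← this]; ring
    rw [e, hF, hp, hq]; ring
  have h2 : q * N = 2 * c * s ^ 2 * (s + c) * (1 - c * s) := by
    rw [← hN, hq]; ring
  -- Complete the square in m. The remainder vanishes at k = 1, which is what determines `N`;
  -- equality there means d = 0 and m = -2csρ/(1 + cs), the common slope ρ/(1 + cs).
  have h3 : q * (2 * p * F) = q * (p * d - l * m) ^ 2 + (q * k * m + 2 * c * s * ρ * p) ^ 2
      + 4 * p * c * s ^ 3 * (1 - c ^ 2) * (1 - k) := by
    rw [h1]
    have e : (q * k * m + 2 * c * s * ρ * p) ^ 2 = (q * k * m) ^ 2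
        + 4 * q * k * m * c * s * ρ * p + 4 * c ^ 2 * s ^ 2 * p ^ 2 * (1 - s ^ 2) := by
      rw [← hρ]; ring
    rw [e]
    have : q * (2 * p * (N - 2 * c * s ^ 3 * k))
        = 2 * p * (2 * c * s ^ 2 * (s + c) * (1 - c * s)) - 4 * p * c * s ^ 3 * k * q := by
      rw [← h2]; ring
    linear_combination this + (4 * c * s ^ 2 * p) *
      (-c * (1 - s ^ 2) * hp - s * k * hq)
  have h4 : 0 ≤ q * (2 * p * F) := by
    rw [h3]
    have : 0 ≤ 4 * p * c * s ^ 3 * (1 - c ^ 2) * (1 - k) :=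
      mul_nonneg (mul_nonneg (by positivity) (by nlinarith)) (by linarith)
    positivity
  have h5 : 0 ≤ 2 * p * F := nonneg_of_mul_nonneg_right h4 hq0
  exact nonneg_of_mul_nonneg_right h5 (by positivity)

/-- The algebraic form of the optimality of the common slope `ρ / (1 + c s)` among all pairs of
slopes `a, b`, for sources of unit variance. -/
lemma sqrt_le_quadratic {c s ρ : ℝ} (a b : ℝ) (hc0 : 0 < c) (hc1 : c < 1) (hs0 : 0 < s)
    (hs1 : s ≤ 1) (hρ : ρ ^ 2 = 1 - s ^ 2) :
    √(c ^ 2 * (2 * s * (1 - a * b)) ^ 2 + ((b - a) * (a + b - 2 * ρ)) ^ 2)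
      ≤ 2 + a ^ 2 + b ^ 2 - 2 * ρ * (a + b) - 2 * (s ^ 2 * (1 - c ^ 2) / (1 + c * s)) := by
  set K := c * (2 * s * (1 - a * b)) with hK
  set D := (b - a) * (a + b - 2 * ρ) with hD
  have hR : c ^ 2 * (2 * s * (1 - a * b)) ^ 2 + D ^ 2 = K ^ 2 + D ^ 2 := by rw [hK]; ring
  rw [hR]
  set N := 2 * c * s ^ 2 * (s + c) / (1 + c * s) with hN
  have hpos : 0 < 1 + c * s := by positivity
  have hL : 2 + a ^ 2 + b ^ 2 - 2 * ρ * (a + b) - 2 * (s ^ 2 * (1 - c ^ 2) / (1 + c * s))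
      = N + ((b - a) ^ 2 + (a + b - 2 * ρ) ^ 2) / 2 := by
    have : N = 2 * s ^ 2 - 2 * (s ^ 2 * (1 - c ^ 2) / (1 + c * s)) := by
      rw [hN]; field_simp; ring
    rw [this]; linear_combination -2 * hρ
  rw [hL]
  have hN0 : 0 ≤ N := by positivity
  have hR0 : 0 ≤ √(K ^ 2 + D ^ 2) := Real.sqrt_nonneg _
  rcases hR0.eq_or_lt with h | h
  · rw [← h]; positivity
  · set R := √(K ^ 2 + D ^ 2) with hRdef
    have hsq : R ^ 2 = K ^ 2 + D ^ 2 := Real.sq_sqrt (by positivity)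
    -- The norm of (K, D) is its inner product with the unit vector (K, D)/R, so the square root
    -- becomes a quadratic polynomial in d and m once that direction is held fixed.
    have := quadratic_nonneg_of_unit (d := b - a) (m := a + b - 2 * ρ) (k := K / R) (l := D / R)
      (N := N) hc0 hc1 hs0 hs1 hρ (by field_simp; linarith) (by rw [hN]; field_simp)
    have e1 : c * s / 2 * (4 * s ^ 2 - 4 * ρ * (a + b - 2 * ρ) + (b - a) ^ 2
        - (a + b - 2 * ρ) ^ 2) = K := by
      rw [hK]; linear_combination (2 * c * s) * hρ
    rw [e1, ← hD] at this
    have e2 : K / R * K + D / R * D = R := by field_simp; linarith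
    linarith

/-! ### Absolute moments of products of Gaussian linear forms. -/

/-- The law of a pair of independent standard Gaussian variables. -/
def gaussianPair : Measure (ℝ × ℝ) := (gaussianReal 0 1).prod (gaussianReal 0 1)

instance : IsProbabilityMeasure gaussianPair := by unfold gaussianPair; infer_instance

open Real in
lemma integral_abs_cos_add_cos {δ : ℝ} (h0 : 0 ≤ δ) (h1 : δ ≤ π) :
    ∫ φ in (-π)..π, |cos φ + cos δ| = 4 * (sin δ + (π / 2 - δ) * cos δ) := by
  have hc : Continuous fun φ ↦ |cos φ + cos δ| := by fun_prop
  have hint : ∀ a b, IntervalIntegrable (fun φ ↦ |cos φ + cos δ|) volume a b :=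
    fun a b ↦ hc.intervalIntegrable a b
  have hneg : ∫ φ in (-π)..0, |cos φ + cos δ| = ∫ φ in 0..π, |cos φ + cos δ| := by
    have := intervalIntegral.integral_comp_neg (a := 0) (b := π) (fun φ ↦ |cos φ + cos δ|)
    simp only [cos_neg, neg_zero] at this
    exact this.symm
  -- On [0, π] the sum cos φ + cos δ changes sign at φ = π - δ.
  have h2 : ∫ φ in 0..(π - δ), |cos φ + cos δ| = ∫ φ in 0..(π - δ), (cos φ + cos δ) := by
    refine intervalIntegral.integral_congr fun φ hφ ↦ abs_of_nonneg ?_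
    rw [Set.uIcc_of_le (by linarith)] at hφ
    have := cos_le_cos_of_nonneg_of_le_pi hφ.1 (by linarith) hφ.2
    rw [cos_pi_sub] at this
    linarith
  have h3 : ∫ φ in (π - δ)..π, |cos φ + cos δ| = ∫ φ in (π - δ)..π, -(cos φ + cos δ) := by
    refine intervalIntegral.integral_congr fun φ hφ ↦ abs_of_nonpos ?_
    rw [Set.uIcc_of_le (by linarith)] at hφ
    have := cos_le_cos_of_nonneg_of_le_pi (by linarith) hφ.2 hφ.1
    rw [cos_pi_sub] at this
    linarith
  rw [← intervalIntegral.integral_add_adjacent_intervals (hint _ 0) (hint 0 _), hneg,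
    ← intervalIntegral.integral_add_adjacent_intervals (hint _ (π - δ)) (hint (π - δ) _), h2, h3,
    intervalIntegral.integral_neg, intervalIntegral.integral_add, intervalIntegral.integral_add,
    integral_cos, integral_cos, intervalIntegral.integral_const, intervalIntegral.integral_const,
    sin_pi_sub]
  · simp; ring
  all_goals exact Continuous.intervalIntegrable (by fun_prop) _ _

open Real in
lemma integral_abs_cos_mul_cos (γ η δ : ℝ) (h0 : 0 ≤ δ) (h1 : δ ≤ π) (h : cos (γ - η) = cos δ) :
    ∫ θ in (-π)..π, |cos (θ - γ) * cos (θ - η)| = 2 * (sin δ + (π / 2 - δ) * cos δ) := by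
  have e : ∀ θ, |cos (θ - γ) * cos (θ - η)| = 1 / 2 * |cos (2 * θ - (γ + η)) + cos δ| := by
    intro θ
    have e' : cos (2 * θ - (γ + η)) + cos δ = 2 * (cos (θ - γ) * cos (θ - η)) := by
      rw [← h, show 2 * θ - (γ + η) = (θ - γ) + (θ - η) by ring,
        ← cos_neg (γ - η), show -(γ - η) = (θ - γ) - (θ - η) by ring, cos_add (θ - γ),
        cos_sub (θ - γ)]
      ring
    rw [e', abs_mul 2, abs_two]
    ring
  simp_rw [e]
  rw [intervalIntegral.integral_const_mul,
    intervalIntegral.integral_comp_mul_sub (fun φ ↦ |cos φ + cos δ|) two_ne_zero]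
  have hper : Function.Periodic (fun φ ↦ |cos φ + cos δ|) (2 * π) := fun φ ↦ by
    simp [cos_add_two_pi]
  have hint : ∀ a b, IntervalIntegrable (fun φ ↦ |cos φ + cos δ|) volume a b :=
    fun a b ↦ Continuous.intervalIntegrable (by fun_prop) a b
  have hp : ∀ t, ∫ φ in t..(t + 2 * π), |cos φ + cos δ| = ∫ φ in (-π)..π, |cos φ + cos δ| := by
    intro t
    rw [hper.intervalIntegral_add_eq t (-π)]
    congr 1; ring
  -- The doubled angle sweeps two full periods.
  have h2 : ∫ φ in (2 * -π - (γ + η))..(2 * π - (γ + η)), |cos φ + cos δ|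
      = 2 * ∫ φ in (-π)..π, |cos φ + cos δ| := by
    rw [← intervalIntegral.integral_add_adjacent_intervals (hint _ (2 * -π - (γ + η) + 2 * π))
      (hint _ _), hp, show 2 * π - (γ + η) = (2 * -π - (γ + η) + 2 * π) + 2 * π by ring, hp]
    ring
  rw [h2, integral_abs_cos_add_cos h0 h1]
  simp; ring

open Real in
lemma integral_pow_three_mul_exp : ∫ r in Set.Ioi (0 : ℝ), r ^ 3 * exp (-r ^ 2 / 2) = 2 := by
  have := integral_rpow_mul_exp_neg_mul_rpow (p := 2) (q := 3) (b := 1 / 2) (by norm_num)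
    (by norm_num) (by norm_num)
  have hG : Gamma 2 = 1 := Gamma_two
  rw [show ((3 : ℝ) + 1) / 2 = 2 by norm_num, hG, show -((3 : ℝ) + 1) / 2 = -2 by norm_num,
    rpow_neg (by norm_num)] at this
  norm_num at this
  refine Eq.trans (setIntegral_congr_fun measurableSet_Ioi fun r _ ↦ ?_) this
  congr 2
  ring

lemma gaussianPair_eq_withDensity :
    gaussianPair = (volume : Measure (ℝ × ℝ)).withDensity
      fun z ↦ gaussianPDF 0 1 z.1 * gaussianPDF 0 1 z.2 := by
  rw [gaussianPair, gaussianReal_of_var_ne_zero _ one_ne_zero,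
    prod_withDensity (measurable_gaussianPDF 0 1) (measurable_gaussianPDF 0 1)]
  rfl

lemma integral_gaussianPair (f : ℝ × ℝ → ℝ) :
    ∫ z, f z ∂gaussianPair = ∫ z : ℝ × ℝ,
      (2 * Real.pi)⁻¹ * Real.exp (-(z.1 ^ 2 + z.2 ^ 2) / 2) * f z := by
  rw [gaussianPair_eq_withDensity, integral_withDensity_eq_integral_toReal_smul]
  · refine integral_congr_ae (.of_forall fun z ↦ ?_)
    simp only [ENNReal.toReal_mul, toReal_gaussianPDF, gaussianPDFReal, smul_eq_mul]
    congr 1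
    simp only [NNReal.coe_one, mul_one, sub_zero]
    rw [mul_mul_mul_comm, ← Real.exp_add, ← mul_inv, Real.mul_self_sqrt (by positivity)]
    congr 2
    ring
  · exact ((measurable_gaussianPDF 0 1).comp measurable_fst).mul
      ((measurable_gaussianPDF 0 1).comp measurable_snd)
  · exact .of_forall fun z ↦ ENNReal.mul_lt_top gaussianPDF_lt_top gaussianPDF_lt_top

-- In polar coordinates the integrand separates into r³ exp(-r²/2) and |cos(θ - γ) cos(θ - η)|.
open Real in
lemma integral_abs_unit_mul_unit (γ η δ : ℝ) (h0 : 0 ≤ δ) (h1 : δ ≤ π)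
    (h : cos (γ - η) = cos δ) :
    ∫ z : ℝ × ℝ, |(cos γ * z.1 + sin γ * z.2) * (cos η * z.1 + sin η * z.2)| ∂gaussianPair
      = 2 / π * (sin δ + (π / 2 - δ) * cos δ) := by
  rw [integral_gaussianPair, ← integral_comp_polarCoord_symm, polarCoord_target]
  have e : ∀ p ∈ Set.Ioi (0 : ℝ) ×ˢ Set.Ioo (-π) π,
      p.1 • ((2 * π)⁻¹ * exp (-((polarCoord.symm p).1 ^ 2 + (polarCoord.symm p).2 ^ 2) / 2) *
        |(cos γ * (polarCoord.symm p).1 + sin γ * (polarCoord.symm p).2) *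
          (cos η * (polarCoord.symm p).1 + sin η * (polarCoord.symm p).2)|)
      = (p.1 ^ 3 * exp (-p.1 ^ 2 / 2)) *
        ((2 * π)⁻¹ * |cos (p.2 - γ) * cos (p.2 - η)|) := by
    rintro ⟨r, θ⟩ ⟨hr, -⟩
    simp only [Set.mem_Ioi] at hr
    simp only [polarCoord_symm_apply, smul_eq_mul]
    rw [show (r * cos θ) ^ 2 + (r * sin θ) ^ 2 = r ^ 2 * (sin θ ^ 2 + cos θ ^ 2) by ring,
      sin_sq_add_cos_sq, mul_one,
      show (cos γ * (r * cos θ) + sin γ * (r * sin θ)) * (cos η * (r * cos θ) + sin η * (r * sin θ))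
        = r ^ 2 * (cos (θ - γ) * cos (θ - η)) by rw [cos_sub, cos_sub]; ring,
      abs_mul (r ^ 2), abs_of_nonneg (sq_nonneg r)]
    ring
  rw [setIntegral_congr_fun (measurableSet_Ioi.prod measurableSet_Ioo) e, Measure.volume_eq_prod,
    setIntegral_prod_mul (fun r : ℝ ↦ r ^ 3 * exp (-r ^ 2 / 2))
      (fun θ ↦ (2 * π)⁻¹ * |cos (θ - γ) * cos (θ - η)|),
    integral_pow_three_mul_exp, ← integral_Ioc_eq_integral_Ioo,
    ← intervalIntegral.integral_of_le (by linarith [pi_pos]),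
    intervalIntegral.integral_const_mul, integral_abs_cos_mul_cos γ η δ h0 h1 h]
  field_simp

open Real in
lemma integral_abs_fst_mul_snd : ∫ z : ℝ × ℝ, |z.1 * z.2| ∂gaussianPair = 2 / π := by
  have := integral_abs_unit_mul_unit 0 (π / 2) (π / 2) (by positivity) (by linarith [pi_pos])
    (by rw [zero_sub, cos_neg])
  simpa using this

open Real in
lemma exists_polar (x y : ℝ) : ∃ r θ : ℝ, 0 ≤ r ∧ x = r * cos θ ∧ y = r * sin θ := by
  let w : ℂ := ⟨x, y⟩
  exact ⟨‖w‖, w.arg, norm_nonneg _, (Complex.norm_mul_cos_arg w).symm,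
    (Complex.norm_mul_sin_arg w).symm⟩

open Real in
/-- The mean absolute value of a product of two linear forms of a standard Gaussian pair. -/
lemma integral_abs_mul_le (g₁ g₂ h₁ h₂ : ℝ) :
    ∫ z : ℝ × ℝ, |(g₁ * z.1 + g₂ * z.2) * (h₁ * z.1 + h₂ * z.2)| ∂gaussianPair
      ≤ √((2 / π) ^ 2 * (g₁ * h₂ - g₂ * h₁) ^ 2 + (g₁ * h₁ + g₂ * h₂) ^ 2) := by
  obtain ⟨r, γ, hr, rfl, rfl⟩ := exists_polar g₁ g₂
  obtain ⟨t, η, ht, rfl, rfl⟩ := exists_polar h₁ h₂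
  -- The angle between the coefficient vectors, folded into [0, π].
  set δ := arccos (cos (γ - η)) with hδ
  have hcos : cos δ = cos (γ - η) := cos_arccos (neg_one_le_cos _) (cos_le_one _)
  have h0 : 0 ≤ δ := arccos_nonneg _
  have h1 : δ ≤ π := arccos_le_pi _
  have e : ∀ z : ℝ × ℝ, |(r * cos γ * z.1 + r * sin γ * z.2) *
      (t * cos η * z.1 + t * sin η * z.2)| = r * t *
        |(cos γ * z.1 + sin γ * z.2) * (cos η * z.1 + sin η * z.2)| := by
    intro z
    rw [show (r * cos γ * z.1 + r * sin γ * z.2) * (t * cos η * z.1 + t * sin η * z.2)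
      = r * t * ((cos γ * z.1 + sin γ * z.2) * (cos η * z.1 + sin η * z.2)) by ring,
      abs_mul (r * t), abs_of_nonneg (by positivity)]
  simp_rw [e]
  rw [integral_const_mul, integral_abs_unit_mul_unit γ η δ h0 h1 hcos.symm]
  have hs : sin δ ^ 2 = sin (γ - η) ^ 2 := by rw [sin_sq, sin_sq, hcos]
  have hR : (2 / π) ^ 2 * (r * cos γ * (t * sin η) - r * sin γ * (t * cos η)) ^ 2
      + (r * cos γ * (t * cos η) + r * sin γ * (t * sin η)) ^ 2
      = (r * t) ^ 2 * ((2 / π) ^ 2 * sin δ ^ 2 + cos δ ^ 2) := by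
    rw [hs, hcos, cos_sub, sin_sub]; ring
  rw [hR, sqrt_mul (by positivity), sqrt_sq (by positivity)]
  exact mul_le_mul_of_nonneg_left (two_div_pi_mul_sin_add_le_sqrt h0 h1) (by positivity)

lemma integrable_sq_gaussianReal : Integrable (fun x : ℝ ↦ x ^ 2) (gaussianReal 0 1) :=
  (memLp_id_gaussianReal' 2 (by simp)).integrable_sq

lemma integral_sq_gaussianReal : ∫ x, x ^ 2 ∂(gaussianReal 0 1) = 1 := by
  have := variance_fun_id_gaussianReal (μ := 0) (v := 1)
  rw [variance_of_integral_eq_zero (by fun_prop) (by simp)] at this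
  simpa using this

lemma integrable_id_gaussianReal : Integrable (fun x : ℝ ↦ x) (gaussianReal 0 1) :=
  (memLp_id_gaussianReal' 1 (by simp)).integrable le_rfl

lemma integrable_quadratic (p q r : ℝ) :
    Integrable (fun z : ℝ × ℝ ↦ p * z.1 ^ 2 + q * (z.1 * z.2) + r * z.2 ^ 2) gaussianPair := by
  unfold gaussianPair
  exact (((integrable_sq_gaussianReal.comp_fst _).const_mul p).add
    ((integrable_id_gaussianReal.mul_prod integrable_id_gaussianReal).const_mul q)).add
    ((integrable_sq_gaussianReal.comp_snd _).const_mul r)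

lemma integral_quadratic (p q r : ℝ) :
    ∫ z : ℝ × ℝ, (p * z.1 ^ 2 + q * (z.1 * z.2) + r * z.2 ^ 2) ∂gaussianPair = p + r := by
  have i1 := (integrable_quadratic p 0 0)
  have i2 := (integrable_quadratic 0 q 0)
  have i3 := (integrable_quadratic 0 0 r)
  simp only [zero_mul, add_zero, zero_add] at i1 i2 i3
  rw [integral_add (f := fun z : ℝ × ℝ ↦ p * z.1 ^ 2 + q * (z.1 * z.2)) (i1.add i2) i3,
    integral_add i1 i2]
  simp only [integral_const_mul]
  unfold gaussianPair
  rw [integral_prod_mul (fun x : ℝ ↦ x) (fun x : ℝ ↦ x),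
    integral_fun_fst (fun x : ℝ ↦ x ^ 2), integral_fun_snd (fun x : ℝ ↦ x ^ 2),
    integral_sq_gaussianReal]
  simp

/-! ### Diagonalisation of the symmetric sources. -/

/-- The pair `(α z₁ + β z₂, α z₁ - β z₂)`. -/
def mix (α β : ℝ) (z : ℝ × ℝ) : Plane := !₂[α * z.1 + β * z.2, α * z.1 - β * z.2]

@[simp] lemma mix_zero (α β : ℝ) (z : ℝ × ℝ) : mix α β z 0 = α * z.1 + β * z.2 := rfl

@[simp] lemma mix_one (α β : ℝ) (z : ℝ × ℝ) : mix α β z 1 = α * z.1 - β * z.2 := rfl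

lemma measurable_mix (α β : ℝ) : Measurable (mix α β) := by
  refine (WithLp.measurable_toLp 2 (Fin 2 → ℝ)).comp (measurable_pi_iff.2 fun i ↦ ?_)
  fin_cases i <;> simp <;> fun_prop

lemma posSemidef_symmetricCov {σ ρ α β : ℝ} (h1 : α ^ 2 + β ^ 2 = σ ^ 2)
    (h2 : α ^ 2 - β ^ 2 = ρ * σ ^ 2) : (symmetricCov σ ρ).PosSemidef := by
  have : symmetricCov σ ρ = !![α, β; α, -β] * !![α, β; α, -β]ᴴ := by
    ext i j
    fin_cases i <;> fin_cases j <;> simp [symmetricCov, Matrix.mul_apply] <;> linarith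
  rw [this]
  exact Matrix.posSemidef_self_mul_conjTranspose _

/-- The characteristic functions agree: pairing `mix α β z` with t gives one term in z₁ and one in
z₂, so independence factors the integral. -/
lemma map_mix_gaussianPair {σ ρ α β : ℝ} (h1 : α ^ 2 + β ^ 2 = σ ^ 2)
    (h2 : α ^ 2 - β ^ 2 = ρ * σ ^ 2) :
    gaussianPair.map (mix α β) = multivariateGaussian 0 (symmetricCov σ ρ) := by
  have : IsProbabilityMeasure (gaussianPair.map (mix α β)) :=
    Measure.isProbabilityMeasure_map (measurable_mix α β).aemeasurable
  apply Measure.ext_of_charFun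
  ext t
  rw [charFun_multivariateGaussian (posSemidef_symmetricCov h1 h2), charFun_apply,
    integral_map (measurable_mix α β).aemeasurable
      (Measurable.aestronglyMeasurable (by fun_prop))]
  have e : ∀ z : ℝ × ℝ, Complex.exp (inner ℝ (mix α β z) t * Complex.I)
      = Complex.exp ((α * (t 0 + t 1) : ℝ) * z.1 * Complex.I)
        * Complex.exp ((β * (t 0 - t 1) : ℝ) * z.2 * Complex.I) := by
    intro z
    rw [← Complex.exp_add]
    congr 1
    simp [PiLp.inner_apply, Fin.sum_univ_two]
    ring
  simp_rw [e]
  unfold gaussianPair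
  rw [integral_prod_mul (fun x : ℝ ↦ Complex.exp ((α * (t 0 + t 1) : ℝ) * x * Complex.I))
    (fun x : ℝ ↦ Complex.exp ((β * (t 0 - t 1) : ℝ) * x * Complex.I)),
    ← charFun_apply_real, ← charFun_apply_real, charFun_gaussianReal, charFun_gaussianReal,
    ← Complex.exp_add]
  congr 1
  have h1' : (α : ℂ) ^ 2 + β ^ 2 = σ ^ 2 := by exact_mod_cast h1
  have h2' : (α : ℂ) ^ 2 - β ^ 2 = ρ * σ ^ 2 := by exact_mod_cast h2
  simp [symmetricCov, Matrix.mulVec, dotProduct, Fin.sum_univ_two]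
  linear_combination (-((t 0 : ℂ) ^ 2 + t 1 ^ 2) / 2) * h1' - (t 0 * t 1 : ℂ) * h2'

/-- `mix α β` as a linear equivalence. -/
def mixEquiv {α β : ℝ} (hα : α ≠ 0) (hβ : β ≠ 0) : (ℝ × ℝ) ≃ₗ[ℝ] Plane where
  toFun := mix α β
  invFun x := ((x 0 + x 1) / (2 * α), (x 0 - x 1) / (2 * β))
  map_add' z w := by ext i; fin_cases i <;> simp <;> ring
  map_smul' r z := by ext i; fin_cases i <;> simp <;> ring
  left_inv z := by ext <;> simp <;> field_simp <;> ring
  right_inv x := by ext i; fin_cases i <;> simp <;> field_simp <;> ring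

/-- For nonzero α and β the map is a linear isomorphism, so it carries Lebesgue measure to a Haar
measure. -/
lemma map_mix_absolutelyContinuous {α β : ℝ} (hα : α ≠ 0) (hβ : β ≠ 0) :
    gaussianPair.map (mix α β) ≪ (volume : Measure Plane) := by
  have h1 : gaussianPair ≪ (volume : Measure (ℝ × ℝ)) := by
    rw [gaussianPair_eq_withDensity]; exact withDensity_absolutelyContinuous _ _
  let L := (mixEquiv hα hβ).toContinuousLinearEquiv
  have h2 : ((volume : Measure (ℝ × ℝ)).map L).IsAddHaarMeasure :=
    L.isAddHaarMeasure_map volume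
  exact (h1.map (measurable_mix α β)).trans
    (Measure.absolutelyContinuous_isAddHaarMeasure ((volume : Measure (ℝ × ℝ)).map L) volume)

/-! ### The cost as an expected minimum of two squared errors. -/

/-- The squared error that the scheduling policy `U` and the estimator with slopes `a` make. -/
lemma squaredError_linearEstimator (U : Plane → Fin 2) (a x : Plane) :
    (x 0 - linearEstimator a (packet U x) 0) ^ 2 + (x 1 - linearEstimator a (packet U x) 1) ^ 2
      = if U x = 0 then (x 1 - a 1 * x 0) ^ 2 else (x 0 - a 0 * x 1) ^ 2 := by
  by_cases h : U x = 0
  · simp [linearEstimator, packet, h]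
  · have h1 : U x = 1 := by omega
    simp [linearEstimator, packet, h1]

lemma measurableSet_max : MeasurableSet {x : Plane | |x 0| ≥ |x 1|} :=
  measurableSet_le (by fun_prop) (by fun_prop)

lemma measurable_maxScheduling : Measurable maxScheduling :=
  Measurable.ite measurableSet_max measurable_const measurable_const

lemma maxScheduling_eq_zero_iff (x : Plane) : maxScheduling x = 0 ↔ |x 1| ≤ |x 0| := by
  unfold maxScheduling
  split_ifs with h
  · simpa using h
  · simpa using h

/-- For a common slope in `[-1, 1]` max-scheduling selects the smaller of the two errors. -/
lemma squaredError_maxScheduling {t : ℝ} (ht : t ^ 2 ≤ 1) (x : Plane) :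
    (if maxScheduling x = 0 then (x 1 - t * x 0) ^ 2 else (x 0 - t * x 1) ^ 2)
      = min ((x 1 - t * x 0) ^ 2) ((x 0 - t * x 1) ^ 2) := by
  simp only [maxScheduling_eq_zero_iff, ← sq_le_sq]
  split_ifs with h
  · rw [min_eq_left]; nlinarith
  · rw [min_eq_right]; nlinarith

lemma lintegral_min_le_cost {Ω : Type*} [MeasurableSpace Ω] (P : Measure Ω) (X : Ω → Plane)
    (U : Plane → Fin 2) (a : Plane) :
    ∫⁻ ω, ENNReal.ofReal (min ((X ω 1 - a 1 * X ω 0) ^ 2) ((X ω 0 - a 0 * X ω 1) ^ 2)) ∂P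
      ≤ cost P X U (linearEstimator a) := by
  refine lintegral_mono fun ω ↦ ENNReal.ofReal_le_ofReal ?_
  rw [squaredError_linearEstimator]
  split_ifs
  · exact min_le_left _ _
  · exact min_le_right _ _

lemma cost_maxScheduling {Ω : Type*} [MeasurableSpace Ω] (P : Measure Ω) (X : Ω → Plane)
    {t : ℝ} (ht : t ^ 2 ≤ 1) :
    cost P X maxScheduling (linearEstimator !₂[t, t]) =
      ∫⁻ ω, ENNReal.ofReal (min ((X ω 1 - t * X ω 0) ^ 2) ((X ω 0 - t * X ω 1) ^ 2)) ∂P := by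
  refine lintegral_congr fun ω ↦ ?_
  rw [squaredError_linearEstimator, ← squaredError_maxScheduling ht]
  rfl

lemma min_sq_eq (u v : ℝ) :
    min (u ^ 2) (v ^ 2) = (u ^ 2 + v ^ 2) / 2 - 1 / 2 * |(u - v) * (u + v)| := by
  rw [show (u - v) * (u + v) = u ^ 2 - v ^ 2 by ring]
  rcases le_total (u ^ 2) (v ^ 2) with h | h
  · rw [min_eq_left h, abs_of_nonpos (by linarith)]; ring
  · rw [min_eq_right h, abs_of_nonneg (by linarith)]; ring

/-- The mean of the smaller of the two squared errors of the estimator with slopes `a, b`, in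
terms of the mean absolute value of a product of linear forms. -/
lemma lintegral_min_eq {Ω : Type*} [MeasurableSpace Ω] {P : Measure Ω} {X : Ω → Plane}
    {α β : ℝ} (hX : HasLaw X (gaussianPair.map (mix α β)) P) (a b : ℝ) :
    ∫⁻ ω, ENNReal.ofReal (min ((X ω 1 - b * X ω 0) ^ 2) ((X ω 0 - a * X ω 1) ^ 2)) ∂P
      = ENNReal.ofReal (((α ^ 2 + β ^ 2) * (2 + a ^ 2 + b ^ 2) -
          2 * (α ^ 2 - β ^ 2) * (a + b)) / 2
        - 1 / 2 * ∫ z : ℝ × ℝ, |(α * (a - b) * z.1 + -(β * (2 + a + b)) * z.2) *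
          (α * (2 - a - b) * z.1 + β * (a - b) * z.2)| ∂gaussianPair) := by
  rw [hX.lintegral_comp (f := fun x : Plane ↦
      ENNReal.ofReal (min ((x 1 - b * x 0) ^ 2) ((x 0 - a * x 1) ^ 2)))
      (Measurable.aemeasurable (by fun_prop)),
    lintegral_map (by fun_prop) (measurable_mix α β)]
  set Q : ℝ × ℝ → ℝ := fun z ↦ (α ^ 2 * ((1 - b) ^ 2 + (1 - a) ^ 2) / 2) * z.1 ^ 2
    + (α * β * (b ^ 2 - a ^ 2)) * (z.1 * z.2)
    + (β ^ 2 * ((1 + b) ^ 2 + (1 + a) ^ 2) / 2) * z.2 ^ 2 with hQ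
  set R : ℝ × ℝ → ℝ := fun z ↦ (α * (a - b) * z.1 + -(β * (2 + a + b)) * z.2) *
          (α * (2 - a - b) * z.1 + β * (a - b) * z.2) with hR
  have hQi : Integrable Q gaussianPair := integrable_quadratic _ _ _
  have hRi : Integrable R gaussianPair := by
    refine (integrable_quadratic (α * (a - b) * (α * (2 - a - b)))
      (α * (a - b) * (β * (a - b)) - β * (2 + a + b) * (α * (2 - a - b)))
      (-(β * (2 + a + b)) * (β * (a - b)))).congr (.of_forall fun z ↦ ?_)
    simp only [hR]; ring
  have e : ∀ z, min ((mix α β z 1 - b * mix α β z 0) ^ 2) ((mix α β z 0 - a * mix α β z 1) ^ 2)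
      = Q z - 1 / 2 * |R z| := by
    intro z
    rw [min_sq_eq]
    congr 1
    · simp only [hQ, mix_zero, mix_one]; ring
    · simp only [hR, mix_zero, mix_one]; congr 2; ring
  simp_rw [e]
  rw [← ofReal_integral_eq_lintegral_ofReal (f := fun z ↦ Q z - 1 / 2 * |R z|) (hQi.sub (hRi.abs.const_mul _))
    (.of_forall fun z ↦ by
      show 0 ≤ Q z - 1 / 2 * |R z|
      rw [← e]; positivity),
    integral_sub hQi (hRi.abs.const_mul _), integral_const_mul, integral_quadratic]
  congr 2
  ring

/-! ### The moment that defines the optimal slope. -/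

/-- The law of the reflected pair `(A, -B)` is that of `(A, B)`. -/
lemma integral_reflect (f : ℝ × ℝ → ℝ) :
    ∫ z : ℝ × ℝ, f (z.1, -z.2) ∂gaussianPair = ∫ z, f z ∂gaussianPair := by
  have h : MeasurePreserving (fun x : ℝ ↦ -x) (gaussianReal 0 1) (gaussianReal 0 1) :=
    ⟨measurable_neg, by rw [gaussianReal_map_neg, neg_zero]⟩
  have h2 := (MeasurePreserving.id (gaussianReal 0 1)).prod h
  exact h2.integral_comp
    ((MeasurableEquiv.refl ℝ).prodCongr (MeasurableEquiv.neg ℝ)).measurableEmbedding f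

lemma ae_mul_ne_zero : ∀ᵐ z : ℝ × ℝ ∂gaussianPair, z.1 * z.2 ≠ 0 := by
  have := nullSingletonClass_gaussianReal (μ := 0) (v := 1) one_ne_zero
  have h : ∀ᵐ x ∂(gaussianReal 0 1), x ≠ 0 := by
    simp [ae_iff]
  have h1 : ∀ᵐ z : ℝ × ℝ ∂gaussianPair, z.1 ≠ 0 := Measure.quasiMeasurePreserving_fst.ae h
  have h2 : ∀ᵐ z : ℝ × ℝ ∂gaussianPair, z.2 ≠ 0 := Measure.quasiMeasurePreserving_snd.ae h
  filter_upwards [h1, h2] with z h1 h2 using mul_ne_zero h1 h2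

lemma integral_max_mix {α β : ℝ} (hα : 0 < α) (hβ : 0 < β) :
    2 * ∫ z, (mix α β z 0) ^ 2 * (if |mix α β z 0| ≥ |mix α β z 1| then (1 : ℝ) else 0)
      ∂gaussianPair = α ^ 2 + β ^ 2 + 2 * α * β * (2 / Real.pi) := by
  set f : ℝ × ℝ → ℝ := fun z ↦
    (mix α β z 0) ^ 2 * (if |mix α β z 0| ≥ |mix α β z 1| then (1 : ℝ) else 0) with hf
  have hmeas : Measurable f := by
    refine Measurable.mul ?_ (Measurable.ite ?_ measurable_const measurable_const)
    · simp only [mix_zero]; fun_prop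
    · exact measurable_mix α β measurableSet_max
  have hint : Integrable f gaussianPair := by
    refine (integrable_quadratic (α ^ 2) (2 * α * β) (β ^ 2)).mono hmeas.aestronglyMeasurable
      (.of_forall fun z ↦ ?_)
    rw [show α ^ 2 * z.1 ^ 2 + 2 * α * β * (z.1 * z.2) + β ^ 2 * z.2 ^ 2 = (mix α β z 0) ^ 2 by
      rw [mix_zero]; ring, hf, norm_mul]
    refine mul_le_of_le_one_right (norm_nonneg _) ?_
    split_ifs <;> simp
  have hprod : Integrable (fun z : ℝ × ℝ ↦ z.1 * z.2) gaussianPair := by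
    simpa using integrable_quadratic 0 1 0
  have hint' : Integrable (fun z : ℝ × ℝ ↦ f (z.1, -z.2)) gaussianPair := by
    have h : MeasurePreserving (fun x : ℝ ↦ -x) (gaussianReal 0 1) (gaussianReal 0 1) :=
      ⟨measurable_neg, by rw [gaussianReal_map_neg, neg_zero]⟩
    exact ((MeasurePreserving.id (gaussianReal 0 1)).prod h).integrable_comp_of_integrable hint
  -- Reflecting z₂ swaps the two sources, so the sum is max(X₁², X₂²). Ties, where z₁z₂ = 0, would
  -- be counted twice but are null.
  have hsum : ∀ᵐ z ∂gaussianPair, f z + f (z.1, -z.2)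
      = (α ^ 2 * z.1 ^ 2 + 0 * (z.1 * z.2) + β ^ 2 * z.2 ^ 2) + 2 * α * β * |z.1 * z.2| := by
    filter_upwards [ae_mul_ne_zero] with z hz
    have hab : 0 < α * β := mul_pos hα hβ
    simp only [hf, mix_zero, mix_one, ge_iff_le, ← sq_le_sq, mul_neg, sub_neg_eq_add,
      ← sub_eq_add_neg]
    have e : (α * z.1 + β * z.2) ^ 2 - (α * z.1 - β * z.2) ^ 2 = 4 * (α * β) * (z.1 * z.2) := by
      ring
    rcases lt_or_gt_of_ne hz with h | h
    · have : (α * z.1 + β * z.2) ^ 2 < (α * z.1 - β * z.2) ^ 2 := by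
        nlinarith [mul_neg_of_pos_of_neg hab h]
      rw [if_neg (not_le.2 this), if_pos this.le, abs_of_neg h]
      ring
    · have : (α * z.1 - β * z.2) ^ 2 < (α * z.1 + β * z.2) ^ 2 := by
        nlinarith [mul_pos hab h]
      rw [if_pos this.le, if_neg (not_le.2 this), abs_of_pos h]
      ring
  rw [two_mul]
  nth_rewrite 2 [← integral_reflect f]
  rw [← integral_add hint hint', integral_congr_ae hsum,
    integral_add (integrable_quadratic _ _ _) (hprod.abs.const_mul _), integral_quadratic,
    integral_const_mul, integral_abs_fst_mul_snd]

lemma two_mul_maxMoment {Ω : Type*} [MeasurableSpace Ω] {P : Measure Ω} [IsProbabilityMeasure P]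
    {X : Ω → Plane} {α β : ℝ} (hX : HasLaw X (gaussianPair.map (mix α β)) P) (hα : 0 < α)
    (hβ : 0 < β) : 2 * maxMoment P X = α ^ 2 + β ^ 2 + 2 * α * β * (2 / Real.pi) := by
  -- Absolute continuity of the law is what makes integration against `pdf` an expectation.
  have hpdf : HasPDF X P volume := by
    refine (hasPDF_iff_of_aemeasurable hX.aemeasurable).2 ⟨inferInstance, ?_⟩
    rw [hX.map_eq]
    exact map_mix_absolutelyContinuous hα.ne' hβ.ne'
  have hmeas : Measurable fun x : Plane ↦
      (x 0) ^ 2 * (if |x 0| ≥ |x 1| then (1 : ℝ) else 0) :=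
    Measurable.mul (by fun_prop) (Measurable.ite measurableSet_max measurable_const
      measurable_const)
  rw [← integral_max_mix hα hβ, maxMoment]
  congr 1
  have h1 : ∫ x : Plane, (pdf X P volume x).toReal •
      ((x 0) ^ 2 * (if |x 0| ≥ |x 1| then (1 : ℝ) else 0)) = _ :=
    pdf.integral_pdf_smul hmeas.aestronglyMeasurable
  simp only [smul_eq_mul] at h1
  simp_rw [mul_comm _ (pdf X P volume _).toReal]
  rw [h1]
  refine (hX.integral_comp hmeas.aestronglyMeasurable).trans ?_
  exact integral_map (measurable_mix α β).aemeasurable hmeas.aestronglyMeasurable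

end SensorScheduling

end

/-! ### Assembly of the optimality proof. -/

theorem theorem4 {Ω : Type*} [MeasurableSpace Ω] (P : Measure Ω) [IsProbabilityMeasure P]
    (σ ρ : ℝ) (hσ : 0 < σ) (hρ0 : 0 ≤ ρ) (hρ1 : ρ < 1)
    (X : Ω → SensorScheduling.Plane)
    (hX : HasLaw X (multivariateGaussian 0 (SensorScheduling.symmetricCov σ ρ)) P) :
    0 < SensorScheduling.maxMoment P X ∧
    SensorScheduling.IsGloballyOptimal P X SensorScheduling.linearEstimators
      SensorScheduling.maxScheduling
      (SensorScheduling.linearEstimator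
        !₂[SensorScheduling.optimalSlope P X σ ρ, SensorScheduling.optimalSlope P X σ ρ]) := by
  open SensorScheduling in
  -- The covariance has eigenvalues σ²(1 ± ρ) with unit eigenvectors (1, ±1)/√2; each coefficient is
  -- the root of an eigenvalue divided by √2.
  set α := σ * √((1 + ρ) / 2) with hα
  set β := σ * √((1 - ρ) / 2) with hβ
  set s := √(1 - ρ ^ 2) with hs
  set c := 2 / Real.pi with hc
  have hα0 : 0 < α := mul_pos hσ (Real.sqrt_pos.2 (by linarith))
  have hβ0 : 0 < β := mul_pos hσ (Real.sqrt_pos.2 (by linarith))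
  have hα2 : α ^ 2 = σ ^ 2 * ((1 + ρ) / 2) := by
    rw [hα, mul_pow, Real.sq_sqrt (by linarith)]
  have hβ2 : β ^ 2 = σ ^ 2 * ((1 - ρ) / 2) := by
    rw [hβ, mul_pow, Real.sq_sqrt (by linarith)]
  have hs0 : 0 < s := Real.sqrt_pos.2 (by nlinarith)
  have hs2 : s ^ 2 = 1 - ρ ^ 2 := Real.sq_sqrt (by nlinarith)
  have hs1 : s ≤ 1 := by nlinarith
  have hαβ : 2 * α * β = σ ^ 2 * s := by
    refine (sq_eq_sq₀ (by positivity) (by positivity)).1 ?_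
    calc (2 * α * β) ^ 2 = 4 * α ^ 2 * β ^ 2 := by ring
      _ = σ ^ 4 * (1 - ρ ^ 2) := by rw [hα2, hβ2]; ring
      _ = (σ ^ 2 * s) ^ 2 := by rw [← hs2]; ring
  have hc0 : 0 < c := by positivity
  have hc1 : c < 1 := by rw [hc, div_lt_one Real.pi_pos]; linarith [Real.pi_gt_three]
  have hcs : 0 < c * s := mul_pos hc0 hs0
  have hadd : α ^ 2 + β ^ 2 = σ ^ 2 := by rw [hα2, hβ2]; ring
  have hsub : α ^ 2 - β ^ 2 = ρ * σ ^ 2 := by rw [hα2, hβ2]; ring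
  rw [← map_mix_gaussianPair hadd hsub] at hX
  have hM : 2 * maxMoment P X = σ ^ 2 * (1 + c * s) := by
    rw [two_mul_maxMoment hX hα0 hβ0, hadd, hαβ]; ring
  refine ⟨by nlinarith [show 0 < σ ^ 2 * (1 + c * s) by positivity], measurable_maxScheduling,
    ⟨_, rfl⟩, ?_⟩
  rintro U - _ ⟨a, rfl⟩
  set t := optimalSlope P X σ ρ with ht
  have ht' : t * (1 + c * s) = ρ := by
    rw [ht, optimalSlope, hM]; field_simp
  have ht0 : 0 ≤ t := by
    by_contra! h
    nlinarith
  have ht1 : t ≤ 1 := by nlinarith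
  rw [cost_maxScheduling P X (by nlinarith)]
  refine le_trans ?_ (lintegral_min_le_cost P X U a)
  rw [lintegral_min_eq hX, lintegral_min_eq hX]
  refine ENNReal.ofReal_le_ofReal ?_
  -- At equal slopes one form involves only z₂ and the other only z₁, so the integral is a multiple
  -- of E|z₁z₂| = c.
  have hopt : ∫ z : ℝ × ℝ, |(α * (t - t) * z.1 + -(β * (2 + t + t)) * z.2) *
      (α * (2 - t - t) * z.1 + β * (t - t) * z.2)| ∂gaussianPair
      = 2 * σ ^ 2 * s * (1 - t ^ 2) * c := by
    have e : ∀ z : ℝ × ℝ, |(α * (t - t) * z.1 + -(β * (2 + t + t)) * z.2) *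
      (α * (2 - t - t) * z.1 + β * (t - t) * z.2)|
        = 2 * σ ^ 2 * s * (1 - t ^ 2) * |z.1 * z.2| := by
      intro z
      rw [show (α * (t - t) * z.1 + -(β * (2 + t + t)) * z.2) *
        (α * (2 - t - t) * z.1 + β * (t - t) * z.2)
          = -((2 * (2 * α * β) * (1 - t ^ 2)) * (z.1 * z.2)) by ring, hαβ, abs_neg, abs_mul,
        abs_of_nonneg (by
          have : 0 ≤ 1 - t ^ 2 := by nlinarith
          positivity)]
      ring
    simp_rw [e]
    rw [integral_const_mul, integral_abs_fst_mul_snd]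
  have hle := integral_abs_mul_le (α * (a 0 - a 1)) (-(β * (2 + a 0 + a 1)))
    (α * (2 - a 0 - a 1)) (β * (a 0 - a 1))
  have hrad : (2 / Real.pi) ^ 2 * (α * (a 0 - a 1) * (β * (a 0 - a 1)) -
      -(β * (2 + a 0 + a 1)) * (α * (2 - a 0 - a 1))) ^ 2 +
      (α * (a 0 - a 1) * (α * (2 - a 0 - a 1)) + -(β * (2 + a 0 + a 1)) * (β * (a 0 - a 1))) ^ 2
      = (σ ^ 2) ^ 2 * (c ^ 2 * (2 * s * (1 - a 0 * a 1)) ^ 2 +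
        ((a 1 - a 0) * (a 0 + a 1 - 2 * ρ)) ^ 2) := by
    have e1 : α * (a 0 - a 1) * (β * (a 0 - a 1)) -
      -(β * (2 + a 0 + a 1)) * (α * (2 - a 0 - a 1)) = σ ^ 2 * (2 * s * (1 - a 0 * a 1)) := by
      linear_combination (2 * (1 - a 0 * a 1)) * hαβ
    have e2 : α * (a 0 - a 1) * (α * (2 - a 0 - a 1)) + -(β * (2 + a 0 + a 1)) * (β * (a 0 - a 1))
        = σ ^ 2 * ((a 1 - a 0) * (a 0 + a 1 - 2 * ρ)) := by
      linear_combination (-(a 0 - a 1) * (a 0 + a 1)) * hadd + (2 * (a 0 - a 1)) * hsub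
    rw [e1, e2, ← hc]; ring
  rw [hrad, Real.sqrt_mul (by positivity), Real.sqrt_sq (by positivity)] at hle
  have halg := mul_le_mul_of_nonneg_left
    (sqrt_le_quadratic (ρ := ρ) (a 0) (a 1) hc0 hc1 hs0 hs1 (by linarith)) (sq_nonneg σ)
  -- The cost at slope t, divided by σ², equals the constant in `sqrt_le_quadratic`.
  have hval : (1 + t ^ 2 - 2 * ρ * t) - s * (1 - t ^ 2) * c = s ^ 2 * (1 - c ^ 2) / (1 + c * s) := by
    rw [← ht'] at hs2 ⊢
    field_simp
    linear_combination -hs2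
  rw [hopt, hadd, hsub]
  rw [← hval] at halg
  linarith
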